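/- Let $U\subseteq\mathbb{R}^N$ be open, $1\le p<\infty$, $0<s<1$, and let $\sigma:U\to(0,\infty]$ be a screening function, i.e. a lower semicontinuous function. Let $\tilde W^{s,p}_{(\sigma)}(U)$ be the space of all real-valued $f\in L^1_{\mathrm{loc}}(U)$ with $$|f|_{\tilde W^{s,p}_{(\sigma)}(U)}:=\left(\int_U\int_{B(x,\sigma(x))\cap U}\frac{|f(y)-f(x)|^p}{|y-x|^{sp+N}}\,dy\,dx\right)^{1/p}<\infty ,$$ where $B(x,\infty)=\mathbb{R}^N$; this is a seminorm. Say that two connected components of $U$ are linked if one contains a point $x$ and the other a point $y$ with $|y-x|<\sigma(x)$. Let $\mathcal{C}$ be the subspace of those $f\in\tilde W^{s,p}_{(\sigma)}(U)$ that are a.e. equal to a constant in each connected component of $U$, and let $\mathcal{C}_\sigma\subseteq\mathcal{C}$ be the subspace of those for which the constants on any two linked components agree. Then: (1) $\tilde W^{s,p}_{(\sigma)}(U)/\mathcal{C}_\sigma$ is a Banach space with the norm $\|[f]\|:=|f|_{\tilde W^{s,p}_{(\sigma)}(U)}$, and it is reflexive if $1<p<\infty$. (2) $\tilde W^{s,p}_{(\sigma)}(U)/\mathbb{R}:=\tilde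 W^{s,p}_{(\sigma)}(U)/\mathcal{C}$ is a Banach space with the quotient norm $\|[f]\|:=\inf_{k\in\mathcal{C}}|f-k|_{\tilde W^{s,p}_{(\sigma)}(U)}$, and it is reflexive if $1<p<\infty$. (3) If no two distinct components of $U$ are linked (in particular if $U$ is connected), then $\mathcal{C}_\sigma=\mathcal{C}$, and the norm in (2) is $\|[f]\|=|f|_{\tilde W^{s,p}_{(\sigma)}(U)}$. -/

import Mathlib

open MeasureTheory TopologicalSpace Topology
open scoped ENNReal

noncomputable section

/-- Lebesgue measure on an open set `U ⊆ ℝ^N`, as a measure on the type of points of `U`. -/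
abbrev lebesgueOn {N : ℕ} (U : Opens (EuclideanSpace ℝ (Fin N))) : Measure U :=
  (volume : Measure (EuclideanSpace ℝ (Fin N))).comap Subtype.val

/-- A screening function on `U`: a lower semicontinuous function `σ : U → (0, ∞]`. -/
structure ScreeningFunction {N : ℕ} (U : Opens (EuclideanSpace ℝ (Fin N))) where
  toFun : U → ℝ≥0∞
  pos : ∀ x, 0 < toFun x
  lsc : LowerSemicontinuous toFun

variable {N : ℕ} {U : Opens (EuclideanSpace ℝ (Fin N))}

/-- The double integral
`∫_U ∫_{B(x, σ(x)) ∩ U} |f(y) - f(x)|^p / |y - x|^(s p + N) dy dx ∈ [0, ∞]`. -/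
def screenedEnergy (σ : ScreeningFunction U) (s p : ℝ) (f : U → ℝ) : ℝ≥0∞ :=
  ∫⁻ x, ∫⁻ y in {y : U | edist y x < σ.toFun x},
    ‖f y - f x‖ₑ ^ p / edist y x ^ (s * p + N) ∂(lebesgueOn U) ∂(lebesgueOn U)

/-- The screened seminorm `|f|`, with values in `[0, ∞]`. -/
def screenedSeminorm (σ : ScreeningFunction U) (s p : ℝ) (f : U → ℝ) : ℝ≥0∞ :=
  screenedEnergy σ s p f ^ (1 / p)

instance isFiniteMeasureOnCompacts_lebesgueOn : IsFiniteMeasureOnCompacts (lebesgueOn U) :=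
  .comap' _ continuous_subtype_val (MeasurableEmbedding.subtype_coe U.isOpen.measurableSet)

instance sigmaFinite_lebesgueOn : SigmaFinite (lebesgueOn U) := by
  have : LocallyCompactSpace U := U.isOpen.locallyCompactSpace
  infer_instance

/-- The `p`-th root of the integrand, extended by zero to all pairs of points of `U`. -/
def screenedRoot (σ : ScreeningFunction U) (s p : ℝ) (f : U → ℝ) : U × U → ℝ≥0∞ :=
  {z : U × U | edist z.2 z.1 < σ.toFun z.1}.indicator
    fun z => ‖f z.2 - f z.1‖ₑ / edist z.2 z.1 ^ ((s * p + N) / p)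

theorem measurableSet_screened (σ : ScreeningFunction U) :
    MeasurableSet {z : U × U | edist z.2 z.1 < σ.toFun z.1} :=
  measurableSet_lt (measurable_snd.edist measurable_fst) (σ.lsc.measurable.comp measurable_fst)

theorem aemeasurable_screenedRoot (σ : ScreeningFunction U) (s p : ℝ) {f : U → ℝ}
    (hf : LocallyIntegrable f (lebesgueOn U)) :
    AEMeasurable (screenedRoot σ s p f) ((lebesgueOn U).prod (lebesgueOn U)) := by
  have h := hf.aestronglyMeasurable.aemeasurable
  refine AEMeasurable.indicator ?_ (measurableSet_screened σ)
  refine AEMeasurable.div (AEMeasurable.enorm (AEMeasurable.sub ?_ ?_)) ?_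
  · exact h.comp_snd
  · exact h.comp_fst
  · exact ((measurable_snd.edist measurable_fst).pow_const _).aemeasurable

theorem screenedEnergy_eq (σ : ScreeningFunction U) (s : ℝ) {p : ℝ} (hp : 0 < p) {f : U → ℝ}
    (hf : LocallyIntegrable f (lebesgueOn U)) :
    screenedEnergy σ s p f =
      ∫⁻ z, screenedRoot σ s p f z ^ p ∂((lebesgueOn U).prod (lebesgueOn U)) := by
  rw [lintegral_prod _ ((aemeasurable_screenedRoot σ s p hf).pow_const p)]
  refine lintegral_congr fun x => ?_
  have hm : MeasurableSet {y : U | edist y x < σ.toFun x} :=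
    measurableSet_lt (measurable_id.edist measurable_const) measurable_const
  rw [← lintegral_indicator hm]
  refine lintegral_congr fun y => ?_
  by_cases hy : edist y x < σ.toFun x
  · simp only [screenedRoot, Set.indicator, Set.mem_ofPred_eq, hy, if_true]
    rw [ENNReal.div_rpow_of_nonneg _ _ hp.le, ← ENNReal.rpow_mul, div_mul_cancel₀ _ hp.ne']
  · simp [screenedRoot, Set.indicator, hy, hp]

theorem screenedRoot_add_le (σ : ScreeningFunction U) (s p : ℝ) (f g : U → ℝ) (z : U × U) :
    screenedRoot σ s p (f + g) z ≤ (screenedRoot σ s p f + screenedRoot σ s p g) z := by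
  by_cases hz : edist z.2 z.1 < σ.toFun z.1
  · simp only [screenedRoot, Set.indicator, Set.mem_ofPred_eq, hz, if_true, Pi.add_apply]
    rw [← ENNReal.add_div]
    gcongr
    rw [add_sub_add_comm]
    exact enorm_add_le _ _
  · simp [screenedRoot, Set.indicator, hz]

theorem screenedSeminorm_add_le (σ : ScreeningFunction U) (s : ℝ) {p : ℝ} (hp : 1 ≤ p)
    {f g : U → ℝ} (hf : LocallyIntegrable f (lebesgueOn U))
    (hg : LocallyIntegrable g (lebesgueOn U)) :
    screenedSeminorm σ s p (f + g) ≤ screenedSeminorm σ s p f + screenedSeminorm σ s p g := by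
  have hp0 : 0 < p := by linarith
  simp only [screenedSeminorm]
  rw [screenedEnergy_eq σ s hp0 hf, screenedEnergy_eq σ s hp0 hg,
    screenedEnergy_eq σ s hp0 (hf.add hg)]
  refine le_trans ?_ (ENNReal.lintegral_Lp_add_le (aemeasurable_screenedRoot σ s p hf)
    (aemeasurable_screenedRoot σ s p hg) hp)
  gcongr with z
  exact screenedRoot_add_le σ s p f g z

theorem screenedSeminorm_smul (σ : ScreeningFunction U) (s : ℝ) {p : ℝ} (hp : 1 ≤ p)
    (c : ℝ) (f : U → ℝ) :
    screenedSeminorm σ s p (c • f) = ‖c‖ₑ * screenedSeminorm σ s p f := by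
  have hp0 : 0 < p := by linarith
  have hc : ‖c‖ₑ ^ p ≠ ∞ := ENNReal.rpow_ne_top_of_nonneg hp0.le enorm_ne_top
  have key : screenedEnergy σ s p (c • f) = ‖c‖ₑ ^ p * screenedEnergy σ s p f := by
    simp only [screenedEnergy]
    rw [← lintegral_const_mul' _ _ hc]
    refine lintegral_congr fun x => ?_
    rw [← lintegral_const_mul' _ _ hc]
    refine lintegral_congr fun y => ?_
    rw [Pi.smul_apply, Pi.smul_apply, ← smul_sub, smul_eq_mul, enorm_mul,
      ENNReal.mul_rpow_of_nonneg _ _ hp0.le, mul_div_assoc]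
  rw [screenedSeminorm, key, ENNReal.mul_rpow_of_nonneg _ _ (by positivity), ← ENNReal.rpow_mul,
    mul_one_div_cancel hp0.ne', ENNReal.rpow_one, screenedSeminorm]

/-- The functions `f ∈ L¹_loc(U)` with finite screened seminorm, as a vector space of functions. -/
def screenedSubmodule (σ : ScreeningFunction U) (s p : ℝ) [hp : Fact (1 ≤ p)] :
    Submodule ℝ (U → ℝ) where
  carrier := {f | LocallyIntegrable f (lebesgueOn U) ∧ screenedSeminorm σ s p f < ∞}
  zero_mem' := by
    refine ⟨locallyIntegrable_zero, ?_⟩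
    have h := screenedSeminorm_smul σ s hp.out 0 0
    rw [zero_smul, enorm_zero, zero_mul] at h
    rw [h]
    exact ENNReal.zero_lt_top
  add_mem' := fun hf hg => ⟨hf.1.add hg.1,
    (screenedSeminorm_add_le σ s hp.out hf.1 hg.1).trans_lt (ENNReal.add_lt_top.2 ⟨hf.2, hg.2⟩)⟩
  smul_mem' := fun c f hf => ⟨hf.1.smul c, by
    rw [screenedSeminorm_smul σ s hp.out]
    exact ENNReal.mul_lt_top enorm_lt_top hf.2⟩

/-- The screened homogeneous fractional Sobolev space. It is a type of its own, so that it carries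
the seminorm topology below and not the topology of pointwise convergence. -/
def ScreenedSpace (σ : ScreeningFunction U) (s p : ℝ) [Fact (1 ≤ p)] : Type :=
  ↥(screenedSubmodule σ s p)

namespace ScreenedSpace

variable {σ : ScreeningFunction U} {s p : ℝ} [hp : Fact (1 ≤ p)]

instance : AddCommGroup (ScreenedSpace σ s p) :=
  inferInstanceAs (AddCommGroup (screenedSubmodule σ s p))

instance : Module ℝ (ScreenedSpace σ s p) :=
  inferInstanceAs (Module ℝ (screenedSubmodule σ s p))

/-- The function underlying an element of the screened space. -/
def toFun (f : ScreenedSpace σ s p) : U → ℝ := f.1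

instance : Norm (ScreenedSpace σ s p) := ⟨fun f => (screenedSeminorm σ s p f.toFun).toReal⟩

theorem seminormedCore : SeminormedSpace.Core ℝ (ScreenedSpace σ s p) where
  norm_nonneg _ := ENNReal.toReal_nonneg
  norm_smul c f := by
    change (screenedSeminorm σ s p (c • f.toFun)).toReal = _
    rw [screenedSeminorm_smul σ s hp.out, ENNReal.toReal_mul, toReal_enorm]
    rfl
  norm_triangle f g := by
    change (screenedSeminorm σ s p (f.toFun + g.toFun)).toReal ≤ _
    refine (ENNReal.toReal_mono (ENNReal.add_lt_top.2 ⟨f.2.2, g.2.2⟩).ne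
      (screenedSeminorm_add_le σ s hp.out f.2.1 g.2.1)).trans ?_
    rw [ENNReal.toReal_add f.2.2.ne g.2.2.ne]
    rfl

/-- The screened space is seminormed by the screened seminorm. -/
instance : SeminormedAddCommGroup (ScreenedSpace σ s p) :=
  SeminormedAddCommGroup.ofCore seminormedCore

instance : NormedSpace ℝ (ScreenedSpace σ s p) where
  norm_smul_le c f := (seminormedCore.norm_smul c f).le

end ScreenedSpace

/-- The functions in the screened space that are almost everywhere equal to a constant in each
connected component of `U`. -/
def locallyConstants (σ : ScreeningFunction U) (s p : ℝ) [Fact (1 ≤ p)] :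
    Submodule ℝ (ScreenedSpace σ s p) where
  carrier := {f | ∀ x : U, ∃ c : ℝ, ∀ᵐ z ∂(lebesgueOn U),
    z ∈ connectedComponent x → f.toFun z = c}
  zero_mem' := fun _ => ⟨0, .of_forall fun _ _ => rfl⟩
  add_mem' := fun {f g} hf hg x => by
    obtain ⟨a, ha⟩ := hf x
    obtain ⟨b, hb⟩ := hg x
    refine ⟨a + b, ?_⟩
    filter_upwards [ha, hb] with z h1 h2 hz
    change f.toFun z + g.toFun z = a + b
    rw [h1 hz, h2 hz]
  smul_mem' := fun r f hf x => by
    obtain ⟨a, ha⟩ := hf x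
    refine ⟨r * a, ?_⟩
    filter_upwards [ha] with z h1 hz
    change r * f.toFun z = r * a
    rw [h1 hz]

/-- The functions in the screened space that are almost everywhere equal to a constant in each
connected component of `U`, with the same constant in any two components that are linked by `σ`,
that is, contain points `x` and `y` respectively with `|y - x| < σ(x)`. -/
def linkedConstants (σ : ScreeningFunction U) (s p : ℝ) [Fact (1 ≤ p)] :
    Submodule ℝ (ScreenedSpace σ s p) where
  carrier := {f | ∀ x y : U, edist y x < σ.toFun x → ∃ c : ℝ, ∀ᵐ z ∂(lebesgueOn U),
    z ∈ connectedComponent x ∪ connectedComponent y → f.toFun z = c}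
  zero_mem' := fun _ _ _ => ⟨0, .of_forall fun _ _ => rfl⟩
  add_mem' := fun {f g} hf hg x y hxy => by
    obtain ⟨a, ha⟩ := hf x y hxy
    obtain ⟨b, hb⟩ := hg x y hxy
    refine ⟨a + b, ?_⟩
    filter_upwards [ha, hb] with z h1 h2 hz
    change f.toFun z + g.toFun z = a + b
    rw [h1 hz, h2 hz]
  smul_mem' := fun r f hf x y hxy => by
    obtain ⟨a, ha⟩ := hf x y hxy
    refine ⟨r * a, ?_⟩
    filter_upwards [ha] with z h1 hz
    change r * f.toFun z = r * a
    rw [h1 hz]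

/-- A real vector space with a given seminorm is a Banach space if the seminorm is a norm and the
space is complete. -/
def IsBanachSpace (X : Type*) [SeminormedAddCommGroup X] [NormedSpace ℝ X] : Prop :=
  (∀ x : X, ‖x‖ = 0 → x = 0) ∧ CompleteSpace X

/-- The canonical map into the bidual is onto. -/
def IsReflexiveSpace (X : Type*) [SeminormedAddCommGroup X] [NormedSpace ℝ X] : Prop :=
  Function.Surjective (NormedSpace.inclusionInDoubleDual ℝ X)

end

/-! The seminorm of `f` is the `L^p` norm of `pairDiff f`, that is `f y - f x`, for the measure
`screenedMeasure` on linked pairs (`screenedSeminorm_eq_eLpNorm`), so the screened space sits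
isometrically in an `L^p` space. Since `σ` is lower semicontinuous, the linked pairs form an open
set containing the diagonal, and near each of them `screenedMeasure` dominates a multiple of `dx dy`
(`exists_prod_restrict_le_screenedMeasure`).

Completeness: an a.e. limit of differences is again a difference, and domination near the diagonal
makes the new function locally integrable. Null space: a vanishing seminorm forces `f` to be locally
constant by the diagonal pairs, and to agree across linked components by the others. Closedness of
`locallyConstants`: inside one component, subtracting a member does not change the differences.

Reflexivity: uniform convexity is stated as an inequality between `p`-th powers, which integrates
from `ℝ` to `L^p`, restricts along the isometry and descends to every quotient; Milman–Pettis then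
applies. -/

noncomputable section

/-! ### Goldstine and Milman–Pettis theorems for seminormed spaces. -/

section Reflexivity

variable {E : Type*} [SeminormedAddCommGroup E] [NormedSpace ℝ E]

/-- A point that satisfies every weak linear inequality satisfied by a convex set is a weak limit of
points of that set. -/
theorem mem_closure_image_of_forall_le {M F : Type*} [AddCommGroup M] [Module ℝ M]
    [AddCommGroup F] [Module ℝ F] (B : M →ₗ[ℝ] F →ₗ[ℝ] ℝ) {S : Set M} (hS : Convex ℝ S) {m : M}
    (hm : ∀ (f : F) (u : ℝ), (∀ a ∈ S, B a f < u) → B m f ≤ u) :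
    (fun f => B m f) ∈ closure ((fun a f => B a f) '' S) := by
  have key : (m : WeakBilin B) ∈ closure (X := WeakBilin B) S := by
    by_contra hmS
    have hconv : Convex ℝ (closure (X := WeakBilin B) S) := Convex.closure (E := WeakBilin B) hS
    obtain ⟨g, u, hg, hu⟩ := geometric_hahn_banach_closed_point hconv isClosed_closure hmS
    -- Weakly continuous functionals are exactly the pairings with some `f`.
    obtain ⟨f, rfl⟩ := LinearMap.dualEmbedding_surjective B g
    exact (hm f u fun a ha => hg a (subset_closure ha)).not_gt hu
  exact image_closure_subset_closure_image (WeakBilin.coeFn_continuous B)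
    (Set.mem_image_of_mem _ key)

/-- **Goldstine's theorem**: the closed ball of radius `r` is pointwise dense in the closed ball of
radius `r` of the bidual. -/
theorem mem_closure_eval_image_closedBall {r : ℝ} (hr : 0 ≤ r)
    (Φ : StrongDual ℝ (StrongDual ℝ E)) (hΦ : ‖Φ‖ ≤ r) :
    (fun f => Φ f) ∈
      closure ((fun (x : E) (f : StrongDual ℝ E) => f x) '' Metric.closedBall 0 r) := by
  let B := topDualPairing ℝ (StrongDual ℝ E)
  let ι : E →ₗ[ℝ] StrongDual ℝ (StrongDual ℝ E) :=
    (NormedSpace.inclusionInDoubleDual ℝ E).toLinearMap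
  have key := mem_closure_image_of_forall_le B (m := Φ)
    ((convex_closedBall (0 : E) r).linear_image ι) ?_
  · rwa [Set.image_image] at key
  intro f u hfu
  have hball : ∀ x : E, ‖x‖ ≤ r → f x < u := fun x hx => hfu _ ⟨x, by simpa using hx, rfl⟩
  have hu0 : 0 < u := by simpa using hball 0 (by simpa using hr)
  have hrf : r * ‖f‖ ≤ u := by
    rcases hr.eq_or_lt with rfl | hr
    · simpa using hu0.le
    rw [← le_div_iff₀' hr]
    -- Only vectors of nonzero norm need testing; these are rescaled to norm `r`, with both signs.
    refine f.opNorm_le_bound' (by positivity) fun x hx => ?_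
    have h1 := hball ((r / ‖x‖) • x) (by
      rw [norm_smul, Real.norm_of_nonneg (by positivity), div_mul_cancel₀ _ hx])
    have h2 := hball (-((r / ‖x‖) • x)) (by
      rw [norm_neg, norm_smul, Real.norm_of_nonneg (by positivity), div_mul_cancel₀ _ hx])
    have hx' : 0 < ‖x‖ := lt_of_le_of_ne (norm_nonneg x) hx.symm
    simp only [map_neg, map_smul, smul_eq_mul] at h1 h2
    have h3 : r / ‖x‖ * |f x| ≤ u := by
      rcases abs_cases (f x) with h | h <;> rw [h.1] <;> linarith
    rw [Real.norm_eq_abs, div_mul_eq_mul_div, le_div_iff₀ hr]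
    rw [div_mul_eq_mul_div, div_le_iff₀ hx'] at h3
    linarith
  exact ((le_abs_self (Φ f)).trans (Φ.le_of_opNorm_le hΦ f)).trans hrf

/-- A homogeneous form of uniform convexity, with exponent `p`. -/
def IsPowerUniformlyConvex (p : ℝ) (E : Type*) [SeminormedAddCommGroup E] [NormedSpace ℝ E] :
    Prop :=
  ∀ η > 0, ∃ C ≥ 0, ∀ x y : E,
    ‖x - y‖ ^ p + C * (‖x + y‖ / 2) ^ p ≤ (η + C / 2) * (‖x‖ ^ p + ‖y‖ ^ p)

/-- Passing to the quotient only decreases the left side. On the right, representatives have norm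
within `t` of the quotient norm, and `t → 0`. -/
theorem IsPowerUniformlyConvex.quotient {p : ℝ} (hp : 0 < p) (h : IsPowerUniformlyConvex p E)
    (S : Submodule ℝ E) : IsPowerUniformlyConvex p (E ⧸ S) := by
  intro η hη
  obtain ⟨C, hC, hCE⟩ := h η hη
  refine ⟨C, hC, fun x y => ?_⟩
  have hcont : Continuous fun t : ℝ =>
      (η + C / 2) * (|‖x‖ + t| ^ p + |‖y‖ + t| ^ p) := by
    have h1 (a : ℝ) : Continuous fun t : ℝ => |a + t| ^ p :=
      (continuous_const.add continuous_id).abs.rpow_const fun _ => .inr hp.le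
    exact continuous_const.mul ((h1 _).add (h1 _))
  have hlim := (hcont.tendsto 0).mono_left (nhdsWithin_le_nhds (s := Set.Ioi 0))
  simp only [add_zero, abs_norm] at hlim
  refine ge_of_tendsto hlim ?_
  filter_upwards [self_mem_nhdsWithin] with t (ht : 0 < t)
  obtain ⟨a, rfl, ha⟩ := Submodule.Quotient.norm_mk_lt x ht
  obtain ⟨b, rfl, hb⟩ := Submodule.Quotient.norm_mk_lt y ht
  rw [abs_of_nonneg (by positivity), abs_of_nonneg (by positivity)]
  calc _ ≤ ‖a - b‖ ^ p + C * (‖a + b‖ / 2) ^ p := by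
        gcongr
        · exact Submodule.Quotient.norm_mk_le (S := S) (a - b)
        · exact Submodule.Quotient.norm_mk_le (S := S) (a + b)
    _ ≤ _ := hCE a b
    _ ≤ _ := by gcongr

/-- In a uniformly convex space, a filter of vectors of norm at most `‖Φ‖` that converges to the
element `Φ` of the bidual in the weak sense is a Cauchy filter for the norm. -/
theorem IsPowerUniformlyConvex.cauchy_of_tendsto {p : ℝ} (hp : 0 < p)
    (h : IsPowerUniformlyConvex p E) (Φ : StrongDual ℝ (StrongDual ℝ E)) {F : Filter E}
    (hF : F.NeBot) (htend : ∀ f : StrongDual ℝ E, Filter.Tendsto (fun x => f x) F (𝓝 (Φ f)))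
    (hball : ∀ᶠ x in F, ‖x‖ ≤ ‖Φ‖) : Cauchy F := by
  have hr : 0 ≤ ‖Φ‖ := norm_nonneg Φ
  generalize hrdef : ‖Φ‖ = r at hr hball
  refine Metric.cauchy_iff.2 ⟨hF, fun ε hε => ?_⟩
  have hη : ∃ η > 0, η * (r ^ p + r ^ p) < ε ^ p := by
    have hc : Continuous fun η : ℝ => η * (r ^ p + r ^ p) := by fun_prop
    have := (hc.tendsto 0).eventually_lt_const (u := ε ^ p)
      (by simpa using Real.rpow_pos_of_pos hε p)
    exact ((this.filter_mono (nhdsWithin_le_nhds (s := Set.Ioi 0))).and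
      self_mem_nhdsWithin).exists.imp fun _ h => ⟨h.2, h.1⟩
  obtain ⟨η, hη0, hη⟩ := hη
  obtain ⟨C, hC, hCE⟩ := h η hη0
  -- At `t = r` the terms with `C` cancel, so any `t < r` close to `r` works. As `‖Φ‖ = r`, a unit
  -- functional `f` has `|Φ f| > t`, and eventually `f x ≥ t` after a change of sign.
  have ht : ∃ t ≥ 0, (η + C / 2) * (r ^ p + r ^ p) - C * t ^ p < ε ^ p ∧
      ∃ f : StrongDual ℝ E, ‖f‖ ≤ 1 ∧ ∀ᶠ x in F, t ≤ f x := by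
    rcases hr.eq_or_lt with hr0 | hr0
    · exact ⟨0, le_rfl, by rw [← hr0] at hη ⊢; simpa [Real.zero_rpow hp.ne'] using hη, 0,
        by simp, by simp⟩
    have hc : Continuous fun t : ℝ => (η + C / 2) * (r ^ p + r ^ p) - C * t ^ p :=
      continuous_const.sub (continuous_const.mul (Real.continuous_rpow_const hp.le))
    have h1 := (hc.tendsto r).eventually_lt_const (u := ε ^ p) (by linarith)
    obtain ⟨t, ⟨ht, ht0⟩, htr⟩ := (((h1.and (lt_mem_nhds hr0)).filter_mono
      (nhdsWithin_le_nhds (s := Set.Iio r))).and self_mem_nhdsWithin).exists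
    refine ⟨t, le_of_lt ht0, ht, ?_⟩
    obtain ⟨f, hf, hft⟩ : ∃ f : StrongDual ℝ E, ‖f‖ = 1 ∧ t < |Φ f| := by
      by_contra! hcon
      exact (htr.trans_eq hrdef.symm).not_ge (Φ.opNorm_le_of_unit_norm (le_of_lt ht0) hcon)
    rcases lt_abs.1 hft with hft | hft
    · exact ⟨f, hf.le, ((htend f).eventually_const_lt hft).mono fun _ h => h.le⟩
    · refine ⟨-f, by rw [norm_neg]; exact hf.le, ?_⟩
      rw [← map_neg] at hft
      exact ((htend (-f)).eventually_const_lt hft).mono fun _ h => h.le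
  obtain ⟨t, ht0, ht, f, hf, hft⟩ := ht
  refine ⟨_, hball.and hft, fun x hx y hy => ?_⟩
  rw [dist_eq_norm]
  -- The functional `f` keeps midpoints from being short, which forces `x` and `y` together.
  have hxy : t ≤ ‖x + y‖ / 2 := by
    have h1 := (le_abs_self _).trans (f.le_of_opNorm_le hf (x + y))
    rw [map_add] at h1
    linarith [hx.2, hy.2]
  refine (Real.rpow_lt_rpow_iff (norm_nonneg _) hε.le hp).1 (lt_of_le_of_lt ?_ ht)
  have h2 : t ^ p ≤ (‖x + y‖ / 2) ^ p := by gcongr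
  have h3 : ‖x‖ ^ p ≤ r ^ p := by gcongr; exact hx.1
  have h4 : ‖y‖ ^ p ≤ r ^ p := by gcongr; exact hy.1
  calc ‖x - y‖ ^ p ≤ (η + C / 2) * (‖x‖ ^ p + ‖y‖ ^ p) - C * (‖x + y‖ / 2) ^ p := by
        linarith [hCE x y]
    _ ≤ _ := by gcongr

/-- The **Milman–Pettis theorem**. -/
theorem IsPowerUniformlyConvex.isReflexiveSpace {p : ℝ} (hp : 0 < p) [CompleteSpace E]
    (h : IsPowerUniformlyConvex p E) : IsReflexiveSpace E := by
  intro Φ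
  set r := ‖Φ‖
  have hr : 0 ≤ r := norm_nonneg Φ
  let ev : E → StrongDual ℝ E → ℝ := fun x f => f x
  let F : Filter E := Filter.comap ev (𝓝 fun f => Φ f) ⊓ Filter.principal (Metric.closedBall 0 r)
  -- Goldstine's theorem says precisely that this filter is proper.
  have hF : F.NeBot := by
    rw [Filter.neBot_iff, Ne, ← Filter.empty_mem_iff_bot]
    intro h0
    rw [Filter.mem_inf_principal, Filter.mem_comap] at h0
    obtain ⟨t, ht, hts⟩ := h0
    obtain ⟨_, htm, x, hx, rfl⟩ := mem_closure_iff_nhds.1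
      (mem_closure_eval_image_closedBall hr Φ le_rfl) t ht
    exact hts htm hx
  have htend (f : StrongDual ℝ E) : Filter.Tendsto (fun x => f x) F (𝓝 (Φ f)) :=
    (((continuous_apply f).tendsto fun f => Φ f).comp Filter.tendsto_comap).mono_left inf_le_left
  have hball : ∀ᶠ x in F, ‖x‖ ≤ r :=
    Filter.mem_inf_of_right (by simp [Set.subset_def])
  have hcauchy := h.cauchy_of_tendsto hp Φ hF htend hball
  obtain ⟨x, hx⟩ := CompleteSpace.complete hcauchy
  refine ⟨x, ContinuousLinearMap.ext fun f => ?_⟩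
  exact tendsto_nhds_unique ((f.continuous.tendsto x).mono_left hx) (htend f)

end Reflexivity

/-! ### Uniform convexity of `ℝ` and of `L^p`. -/

section UniformConvexity

/-- The strict convexity of `t ↦ |t| ^ p`, at midpoints. -/
theorem abs_add_div_two_rpow_lt {p : ℝ} (hp : 1 < p) {a b : ℝ} (hab : a ≠ b) :
    (|a + b| / 2) ^ p < (|a| ^ p + |b| ^ p) / 2 := by
  have hp0 : 0 < p := by linarith
  have hle : |a + b| / 2 ≤ (2⁻¹ : ℝ) • |a| + (2⁻¹ : ℝ) • |b| := by
    simp only [smul_eq_mul]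
    linarith [abs_add_le a b]
  -- Strict convexity on `[0, ∞)` needs `|a| ≠ |b|`; otherwise `a = -b` and the midpoint is zero.
  rcases eq_or_ne |a| |b| with h | h
  · have hba : a = -b := (abs_eq_abs.1 h).resolve_left hab
    have hb : b ≠ 0 := fun h0 => hab (by simp [hba, h0])
    have : 0 < |b| ^ p := Real.rpow_pos_of_pos (abs_pos.2 hb) p
    rw [hba, neg_add_cancel, abs_zero, zero_div, Real.zero_rpow hp0.ne', abs_neg]
    linarith
  · have := (strictConvexOn_rpow hp).2 (abs_nonneg a) (abs_nonneg b) h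
      (show (0 : ℝ) < 2⁻¹ by norm_num) (show (0 : ℝ) < 2⁻¹ by norm_num) (by norm_num)
    refine (Real.rpow_le_rpow (by positivity) hle hp0.le).trans_lt (this.trans_eq ?_)
    simp only [smul_eq_mul]
    ring

/-- By homogeneity it suffices to treat the unit sphere of `ℝ × ℝ`. Off the compact set `K` the term
with `η` absorbs `|a - b| ^ p`. On `K` one has `a ≠ b`, so the midpoint deficit is at least some `m
> 0`, and a large multiple of it does the job. -/
theorem isPowerUniformlyConvex_real {p : ℝ} (hp : 1 < p) : IsPowerUniformlyConvex p ℝ := by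
  have hp0 : 0 < p := by linarith
  intro η hη
  let K : Set (ℝ × ℝ) := Metric.sphere 0 1 ∩
    {z | η * (|z.1| ^ p + |z.2| ^ p) ≤ |z.1 - z.2| ^ p}
  have hc : ∀ g : ℝ × ℝ → ℝ, Continuous g → Continuous fun z => |g z| ^ p := fun g hg =>
    hg.abs.rpow_const fun _ => .inr hp0.le
  have c1 := hc _ continuous_fst
  have c2 := hc _ continuous_snd
  have c3 := hc _ (continuous_fst.sub continuous_snd)
  have c4 : Continuous fun z : ℝ × ℝ => (|z.1 + z.2| / 2) ^ p :=
    ((continuous_fst.add continuous_snd).abs.div_const 2).rpow_const fun _ => .inr hp0.le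
  have hK : IsCompact K := (isCompact_sphere 0 1).inter_right
    (isClosed_le (continuous_const.mul (c1.add c2)) c3)
  have hpos : ∀ z : ℝ × ℝ, z ≠ 0 → 0 < |z.1| ^ p + |z.2| ^ p := by
    intro z hz
    have : z.1 ≠ 0 ∨ z.2 ≠ 0 := by
      by_contra! h
      exact hz (Prod.ext h.1 h.2)
    rcases this with h | h
    · have := Real.rpow_pos_of_pos (abs_pos.2 h) p
      positivity
    · have := Real.rpow_pos_of_pos (abs_pos.2 h) p
      positivity
  obtain ⟨m, hm, hmK⟩ := hK.exists_forall_le'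
    (f := fun z => (|z.1| ^ p + |z.2| ^ p) / 2 - (|z.1 + z.2| / 2) ^ p)
    (((c1.add c2).div_const 2).sub c4).continuousOn (a := 0) fun z hz => by
      refine sub_pos.2 (abs_add_div_two_rpow_lt hp fun h => ?_)
      have h1 : η * (|z.1| ^ p + |z.2| ^ p) ≤ |z.1 - z.2| ^ p := hz.2
      rw [h, sub_self, abs_zero, Real.zero_rpow hp0.ne'] at h1
      have h0 : z ≠ 0 := ne_zero_of_mem_unit_sphere ⟨z, hz.1⟩
      have := mul_pos hη (hpos z h0)
      rw [h] at this
      linarith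
  obtain ⟨M, hM⟩ := hK.bddAbove_image c3.continuousOn
  -- `M` may be negative when `K` is empty.
  refine ⟨max M 0 / m, by positivity, ?_⟩
  set C := max M 0 / m
  have hC : 0 ≤ C := by positivity
  have hunit : ∀ z : ℝ × ℝ, ‖z‖ = 1 →
      |z.1 - z.2| ^ p + C * (|z.1 + z.2| / 2) ^ p ≤ (η + C / 2) * (|z.1| ^ p + |z.2| ^ p) := by
    intro z hz
    by_cases hzK : z ∈ K
    · have h1 : |z.1 - z.2| ^ p ≤ C * m := by
        rw [div_mul_cancel₀ _ hm.ne']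
        exact (hM ⟨z, hzK, rfl⟩).trans (le_max_left _ _)
      have h2 := mul_le_mul_of_nonneg_left (hmK z hzK) hC
      have h3 : 0 ≤ η * (|z.1| ^ p + |z.2| ^ p) := by positivity
      linarith
    · have h1 : |z.1 - z.2| ^ p < η * (|z.1| ^ p + |z.2| ^ p) := by
        by_contra! h
        exact hzK ⟨by simpa using hz, h⟩
      have h2 : (|z.1 + z.2| / 2) ^ p ≤ (|z.1| ^ p + |z.2| ^ p) / 2 := by
        rcases eq_or_ne z.1 z.2 with h | h
        · rw [h, ← two_mul, abs_mul, abs_two, mul_div_cancel_left₀ _ two_ne_zero]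
          linarith
        · exact (abs_add_div_two_rpow_lt hp h).le
      linarith [mul_le_mul_of_nonneg_left h2 hC]
  intro a b
  simp only [Real.norm_eq_abs]
  rcases eq_or_ne (a, b) 0 with h | h
  · obtain ⟨rfl, rfl⟩ := Prod.mk.inj h
    simp [Real.zero_rpow hp0.ne']
  have hr : 0 < ‖(a, b)‖ := norm_pos_iff.2 h
  set r := ‖(a, b)‖
  have key := hunit (r⁻¹ • (a, b)) (by rw [norm_smul, norm_inv, norm_norm, inv_mul_cancel₀ hr.ne'])
  have hmul : ∀ t : ℝ, |r⁻¹ * t| ^ p = r⁻¹ ^ p * |t| ^ p := fun t => by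
    rw [abs_mul, abs_of_pos (inv_pos.2 hr), Real.mul_rpow (by positivity) (abs_nonneg t)]
  have hdiv : ∀ t : ℝ, (|t| / 2) ^ p = |t| ^ p / 2 ^ p := fun t =>
    Real.div_rpow (abs_nonneg t) zero_le_two p
  simp only [Prod.smul_fst, Prod.smul_snd, smul_eq_mul, ← mul_sub, ← mul_add, hdiv, hmul] at key ⊢
  refine le_of_mul_le_mul_left ?_ (Real.rpow_pos_of_pos (inv_pos.2 hr) p)
  linear_combination key

/-- All terms are integrals of `p`-th powers, so the scalar inequality integrates with the same `C`.
-/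
theorem isPowerUniformlyConvex_Lp {α : Type*} [MeasurableSpace α] (ν : Measure α) {p : ℝ}
    (hp : 1 < p) [Fact (1 ≤ ENNReal.ofReal p)] :
    IsPowerUniformlyConvex p (Lp ℝ (ENNReal.ofReal p) ν) := by
  have hp0 : 0 < p := by linarith
  have hP : (ENNReal.ofReal p).toReal = p := ENNReal.toReal_ofReal hp0.le
  have hnorm : ∀ f : Lp ℝ (ENNReal.ofReal p) ν, ‖f‖ ^ p = ∫ x, ‖f x‖ ^ p ∂ν := fun f => by
    rw [Lp.norm_def, (Lp.memLp f).eLpNorm_eq_integral_rpow_norm (by simpa using hp0) (by simp), hP,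
      ENNReal.toReal_ofReal (by positivity), ← Real.rpow_mul (by positivity),
      inv_mul_cancel₀ hp0.ne', Real.rpow_one]
  have hint : ∀ f : Lp ℝ (ENNReal.ofReal p) ν, Integrable (fun x => ‖f x‖ ^ p) ν := fun f => by
    simpa only [hP] using (Lp.memLp f).integrable_norm_rpow (by simpa using hp0) (by simp)
  intro η hη
  obtain ⟨C, hC, h⟩ := isPowerUniformlyConvex_real hp η hη
  refine ⟨C, hC, fun f g => ?_⟩
  rw [Real.div_rpow (norm_nonneg _) zero_le_two, hnorm, hnorm, hnorm, hnorm,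
    ← integral_add (hint f) (hint g),
    ← integral_const_mul, ← integral_div, ← integral_const_mul,
    ← integral_add (hint _) (((hint _).div_const _).const_mul _)]
  refine integral_mono_ae ((hint _).add (((hint _).div_const _).const_mul _))
    (((hint f).add (hint g)).const_mul _) ?_
  filter_upwards [Lp.coeFn_add f g, Lp.coeFn_sub f g] with x h1 h2
  have := h (f x) (g x)
  rw [Real.div_rpow (norm_nonneg _) zero_le_two] at this
  simpa only [h1, h2, Pi.add_apply, Pi.sub_apply] using this

end UniformConvexity

variable {N : ℕ} {U : Opens (EuclideanSpace ℝ (Fin N))}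

/-! ### The weighted measure on linked pairs. -/

section ScreenedMeasure

instance isOpenPosMeasure_lebesgueOn : (lebesgueOn U).IsOpenPosMeasure :=
  Measure.IsOpenPosMeasure.comap volume U.isOpen.isOpenEmbedding_subtypeVal

/-- The pairs of points that are linked by `σ`. -/
def screenedSet (σ : ScreeningFunction U) : Set (U × U) := {z | edist z.2 z.1 < σ.toFun z.1}

/-- The measure `dx dy / |y - x| ^ (s p + N)` on the pairs of points linked by `σ`. -/
def screenedMeasure (σ : ScreeningFunction U) (s p : ℝ) : Measure (U × U) :=
  (((lebesgueOn U).prod (lebesgueOn U)).restrict (screenedSet σ)).withDensity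
    fun z => (edist z.2 z.1 ^ (s * p + N))⁻¹

/-- The difference `f y - f x`, as a function of the pair `(x, y)`. -/
def pairDiff (f : U → ℝ) : U × U → ℝ := fun z => f z.2 - f z.1

theorem pairDiff_sub (f g : U → ℝ) : pairDiff (f - g) = pairDiff f - pairDiff g := by
  ext z
  simp only [pairDiff, Pi.sub_apply]
  ring

theorem pairDiff_add (f g : U → ℝ) : pairDiff (f + g) = pairDiff f + pairDiff g := by
  ext z
  simp only [pairDiff, Pi.add_apply]
  ring

variable (σ : ScreeningFunction U) (s p : ℝ)

/-- Lower semicontinuity of `σ` preserves `t < σ x` nearby, for a `t` strictly between the distance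
and `σ x`. -/
theorem isOpen_screenedSet : IsOpen (screenedSet σ) := by
  refine isOpen_iff_mem_nhds.2 fun z hz => ?_
  obtain ⟨t, h1, h2⟩ := exists_between (show edist z.2 z.1 < σ.toFun z.1 from hz)
  have e1 : ∀ᶠ w : U × U in 𝓝 z, edist w.2 w.1 < t :=
    (continuous_snd.edist continuous_fst).continuousAt.eventually_lt_const h1
  have e2 : ∀ᶠ w : U × U in 𝓝 z, t < σ.toFun w.1 :=
    continuous_fst.continuousAt.eventually (σ.lsc z.1 t h2)
  filter_upwards [e1, e2] with w h3 h4 using h3.trans h4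

theorem measurable_screenedDensity :
    Measurable fun z : U × U => (edist z.2 z.1 ^ (s * p + N))⁻¹ :=
  ((measurable_snd.edist measurable_fst).pow_const _).inv

theorem screenedMeasure_absolutelyContinuous :
    screenedMeasure σ s p ≪ (lebesgueOn U).prod (lebesgueOn U) :=
  (withDensity_absolutelyContinuous _ _).trans Measure.restrict_le_self.absolutelyContinuous

theorem ae_screenedMeasure_iff (hs : 0 ≤ s * p + N) {P : U × U → Prop} :
    (∀ᵐ z ∂screenedMeasure σ s p, P z) ↔
      ∀ᵐ z ∂(lebesgueOn U).prod (lebesgueOn U), z ∈ screenedSet σ → P z := by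
  rw [screenedMeasure, ae_withDensity_iff (measurable_screenedDensity s p),
    ae_restrict_iff' (isOpen_screenedSet σ).measurableSet]
  refine Filter.eventually_congr (.of_forall fun z => imp_congr_right fun _ => ?_)
  refine ⟨fun h => h ?_, fun h _ => h⟩
  exact ENNReal.inv_ne_zero.2 (ENNReal.rpow_ne_top_of_nonneg hs (edist_ne_top _ _))

variable {s p}

theorem aestronglyMeasurable_pairDiff {f : U → ℝ} (hf : LocallyIntegrable f (lebesgueOn U)) :
    AEStronglyMeasurable (pairDiff f) (screenedMeasure σ s p) :=
  AEStronglyMeasurable.mono_ac (screenedMeasure_absolutelyContinuous σ s p)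
    (hf.aestronglyMeasurable.comp_snd.sub hf.aestronglyMeasurable.comp_fst)

theorem screenedSeminorm_eq_eLpNorm (hp : 0 < p) {f : U → ℝ}
    (hf : LocallyIntegrable f (lebesgueOn U)) :
    screenedSeminorm σ s p f =
      eLpNorm (pairDiff f) (ENNReal.ofReal p) (screenedMeasure σ s p) := by
  have hm : AEMeasurable (pairDiff f)
      (((lebesgueOn U).prod (lebesgueOn U)).restrict (screenedSet σ)) :=
    (hf.aestronglyMeasurable.comp_snd.sub hf.aestronglyMeasurable.comp_fst).aemeasurable.restrict
  rw [eLpNorm_eq_lintegral_rpow_enorm_toReal (by simpa using hp) (by simp),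
    ENNReal.toReal_ofReal hp.le, screenedSeminorm, screenedEnergy_eq σ s hp hf, screenedMeasure,
    lintegral_withDensity_eq_lintegral_mul₀ (measurable_screenedDensity s p).aemeasurable
      (hm.enorm.pow_const p),
    ← lintegral_indicator (isOpen_screenedSet σ).measurableSet]
  congr 1
  refine lintegral_congr fun z => ?_
  by_cases hz : z ∈ screenedSet σ
  · rw [screenedRoot, show {z : U × U | edist z.2 z.1 < σ.toFun z.1} = screenedSet σ from rfl,
      Set.indicator_of_mem hz, Set.indicator_of_mem hz,
      ENNReal.div_rpow_of_nonneg _ _ hp.le, ← ENNReal.rpow_mul, div_mul_cancel₀ _ hp.ne',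
      Pi.mul_apply, div_eq_mul_inv, mul_comm, pairDiff]
  · rw [screenedRoot, show {z : U × U | edist z.2 z.1 < σ.toFun z.1} = screenedSet σ from rfl,
      Set.indicator_of_notMem hz, Set.indicator_of_notMem hz,
      ENNReal.zero_rpow_of_pos hp]

/-- Near a linked pair of points, the screened measure dominates a product measure. -/
theorem exists_prod_restrict_le_screenedMeasure (hs : 0 ≤ s * p + N) {x y : U}
    (hxy : edist y x < σ.toFun x) :
    ∃ A B : Set U, IsOpen A ∧ IsOpen B ∧ x ∈ A ∧ y ∈ B ∧ lebesgueOn U A < ∞ ∧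
      lebesgueOn U B < ∞ ∧ ∃ c : ℝ≥0∞, c ≠ ∞ ∧
        ((lebesgueOn U).restrict A).prod ((lebesgueOn U).restrict B) ≤
          c • screenedMeasure σ s p := by
  have : LocallyCompactSpace U := U.isOpen.locallyCompactSpace
  -- Where the distance is below `R`, the density is at least `(R ^ (s * p + N))⁻¹`. Adding `1`
  -- keeps `R` positive when `x = y`.
  set R := edist y x + 1
  have hR : R ≠ ∞ := ENNReal.add_ne_top.2 ⟨edist_ne_top _ _, ENNReal.one_ne_top⟩
  have hR0 : R ≠ 0 := by simp [R]
  have hR1 : edist y x < R := ENNReal.lt_add_right (edist_ne_top _ _) one_ne_zero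
  have hO : IsOpen (screenedSet σ ∩ {z : U × U | edist z.2 z.1 < R}) :=
    (isOpen_screenedSet σ).inter
      (isOpen_lt (continuous_snd.edist continuous_fst) continuous_const)
  obtain ⟨A, B, hA, hB, hxA, hyB, hAB⟩ := isOpen_prod_iff.1 hO x y ⟨hxy, hR1⟩
  obtain ⟨A', hxA', hA', hA'm⟩ := (lebesgueOn U).exists_isOpen_measure_lt_top x
  obtain ⟨B', hyB', hB', hB'm⟩ := (lebesgueOn U).exists_isOpen_measure_lt_top y
  refine ⟨A ∩ A', B ∩ B', hA.inter hA', hB.inter hB', ⟨hxA, hxA'⟩, ⟨hyB, hyB'⟩,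
    (measure_mono Set.inter_subset_right).trans_lt hA'm,
    (measure_mono Set.inter_subset_right).trans_lt hB'm, R ^ (s * p + N),
    ENNReal.rpow_ne_top_of_nonneg hs hR, ?_⟩
  have hsub : (A ∩ A') ×ˢ (B ∩ B') ⊆ screenedSet σ ∩ {z : U × U | edist z.2 z.1 < R} :=
    (Set.prod_mono Set.inter_subset_left Set.inter_subset_left).trans hAB
  have hmeas : MeasurableSet ((A ∩ A') ×ˢ (B ∩ B')) :=
    ((hA.inter hA').prod (hB.inter hB')).measurableSet
  rw [Measure.prod_restrict]
  set Q := (A ∩ A') ×ˢ (B ∩ B')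
  refine Measure.le_iff.2 fun T hT => ?_
  rw [Measure.restrict_apply hT, Measure.smul_apply, smul_eq_mul, screenedMeasure,
    withDensity_apply _ hT, Measure.restrict_restrict hT]
  have hRs : R ^ (s * p + N) ≠ 0 := by simp [ENNReal.rpow_eq_zero_iff, hR0, hR]
  calc ((lebesgueOn U).prod (lebesgueOn U)) (T ∩ Q)
      = R ^ (s * p + N) * ∫⁻ _ in T ∩ Q, (R ^ (s * p + N))⁻¹
          ∂(lebesgueOn U).prod (lebesgueOn U) := by
        rw [setLIntegral_const, ← mul_assoc,
          ENNReal.mul_inv_cancel hRs (ENNReal.rpow_ne_top_of_nonneg hs hR), one_mul]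
    _ ≤ R ^ (s * p + N) * ∫⁻ z in T ∩ Q, (edist z.2 z.1 ^ (s * p + N))⁻¹
          ∂(lebesgueOn U).prod (lebesgueOn U) := by
        gcongr 1
        refine setLIntegral_mono' (hT.inter hmeas) fun z hz => ?_
        exact ENNReal.inv_le_inv.2 (ENNReal.rpow_le_rpow (hsub hz.2).2.le hs)
    _ ≤ _ := by
        gcongr 1
        exact lintegral_mono_set (Set.inter_subset_inter_right T fun z hz => (hsub hz).1)

end ScreenedMeasure

/-! ### The isometry into `L^p`. -/

namespace ScreenedSpace

variable {σ : ScreeningFunction U} {s p : ℝ} [hp : Fact (1 ≤ p)]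

theorem locallyIntegrable (f : ScreenedSpace σ s p) :
    LocallyIntegrable f.toFun (lebesgueOn U) := f.2.1

theorem screenedSeminorm_lt_top (f : ScreenedSpace σ s p) :
    screenedSeminorm σ s p f.toFun < ∞ := f.2.2

theorem memLp_pairDiff (f : ScreenedSpace σ s p) :
    MemLp (pairDiff f.toFun) (ENNReal.ofReal p) (screenedMeasure σ s p) :=
  have hp0 : 0 < p := by linarith [hp.out]
  ⟨aestronglyMeasurable_pairDiff σ f.locallyIntegrable, by
    rw [← screenedSeminorm_eq_eLpNorm σ hp0 f.locallyIntegrable]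
    exact f.screenedSeminorm_lt_top⟩

theorem norm_eq_eLpNorm (f : ScreenedSpace σ s p) :
    ‖f‖ = (eLpNorm (pairDiff f.toFun) (ENNReal.ofReal p) (screenedMeasure σ s p)).toReal := by
  have hp0 : 0 < p := by linarith [hp.out]
  rw [← screenedSeminorm_eq_eLpNorm σ hp0 f.locallyIntegrable]
  rfl

theorem enorm_eq_eLpNorm (f : ScreenedSpace σ s p) :
    ‖f‖ₑ = eLpNorm (pairDiff f.toFun) (ENNReal.ofReal p) (screenedMeasure σ s p) := by
  rw [← ofReal_norm, norm_eq_eLpNorm, ENNReal.ofReal_toReal f.memLp_pairDiff.2.ne]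

theorem toFun_sub (f g : ScreenedSpace σ s p) : (f - g).toFun = f.toFun - g.toFun := rfl

theorem toFun_add (f g : ScreenedSpace σ s p) : (f + g).toFun = f.toFun + g.toFun := rfl

theorem isPowerUniformlyConvex (hp1 : 1 < p) : IsPowerUniformlyConvex p (ScreenedSpace σ s p) := by
  have : Fact (1 ≤ ENNReal.ofReal p) := ⟨ENNReal.one_le_ofReal.2 hp.out⟩
  intro η hη
  obtain ⟨C, hC, h⟩ := isPowerUniformlyConvex_Lp (screenedMeasure σ s p) hp1 η hη
  have key (f : ScreenedSpace σ s p) : ‖f‖ = ‖f.memLp_pairDiff.toLp‖ := by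
    rw [Lp.norm_toLp, norm_eq_eLpNorm]
  refine ⟨C, hC, fun f g => ?_⟩
  have hadd : (f + g).memLp_pairDiff.toLp = f.memLp_pairDiff.toLp + g.memLp_pairDiff.toLp := by
    rw [← MemLp.toLp_add]
    congr 1
    rw [toFun_add, pairDiff_add]
  have hsub : (f - g).memLp_pairDiff.toLp = f.memLp_pairDiff.toLp - g.memLp_pairDiff.toLp := by
    rw [← MemLp.toLp_sub]
    congr 1
    rw [toFun_sub, pairDiff_sub]
  rw [key (f - g), key (f + g), key f, key g, hadd, hsub]
  exact h _ _

end ScreenedSpace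

/-! ### Completeness of the screened space. -/

section Completeness

theorem ae_restrict_neBot_of_isOpen {A : Set U} (hA : IsOpen A) {x : U} (hx : x ∈ A) :
    (ae ((lebesgueOn U).restrict A)).NeBot :=
  ae_restrict_neBot.2 (hA.measure_ne_zero _ ⟨x, hx⟩)

/-- Near the diagonal `pairDiff f` is integrable for `dx dy` on a product of finite measure. By
Fubini some slice `f - f a` is integrable, hence so is `f`. No measurability of `f` is assumed: the
slice provides it. -/
theorem locallyIntegrable_of_memLp_pairDiff (σ : ScreeningFunction U) {s p : ℝ} (hp : 1 ≤ p)
    (hs : 0 ≤ s * p + N) {f : U → ℝ}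
    (hf : MemLp (pairDiff f) (ENNReal.ofReal p) (screenedMeasure σ s p)) :
    LocallyIntegrable f (lebesgueOn U) := by
  intro x
  obtain ⟨A, B, hA, hB, hxA, hxB, hAm, hBm, c, hc, hle⟩ :=
    exists_prod_restrict_le_screenedMeasure σ hs (x := x) (y := x) (by simpa using σ.pos x)
  have : IsFiniteMeasure ((lebesgueOn U).restrict A) := ⟨by simpa using hAm⟩
  have : IsFiniteMeasure ((lebesgueOn U).restrict B) := ⟨by simpa using hBm⟩
  have := ae_restrict_neBot_of_isOpen hA hxA
  have hint := (hf.of_measure_le_smul hc hle).integrable (ENNReal.one_le_ofReal.2 hp)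
  obtain ⟨a, ha⟩ := hint.prod_right_ae.exists
  refine ⟨B, hB.mem_nhds hxB, ?_⟩
  refine (ha.add (integrable_const (f a))).congr (.of_forall fun y => ?_)
  simp [pairDiff]

/-- The points `x` and `y` are equivalent if `u n y - u n x` converges. -/
def diffSetoid (u : ℕ → U → ℝ) : Setoid U where
  r x y := ∃ l, Filter.Tendsto (fun n => u n y - u n x) Filter.atTop (𝓝 l)
  iseqv :=
    { refl := fun x => ⟨0, by simp⟩
      symm := fun ⟨l, hl⟩ => ⟨-l, by simpa using hl.neg⟩
      trans := fun ⟨l, hl⟩ ⟨m, hm⟩ => ⟨m + l, by simpa using hm.add hl⟩ }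

/-- If the differences converge for almost all pairs of points, then they converge to the difference
of a function. -/
theorem exists_tendsto_pairDiff (u : ℕ → U → ℝ) {ν : Measure (U × U)}
    (h : ∀ᵐ z ∂ν, ∃ l, Filter.Tendsto (fun n => pairDiff (u n) z) Filter.atTop (𝓝 l)) :
    ∃ f : U → ℝ, ∀ᵐ z ∂ν,
      Filter.Tendsto (fun n => pairDiff (u n) z) Filter.atTop (𝓝 (pairDiff f z)) := by
  let S := diffSetoid u
  -- One base point per class fixes the free additive constant; a pair with convergent differences
  -- shares its base point, which cancels.
  let r : U → U := fun x => (Quotient.mk S x).out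
  have hr : ∀ x, ∃ l, Filter.Tendsto (fun n => u n x - u n (r x)) Filter.atTop (𝓝 l) :=
    fun x => Quotient.mk_out (s := S) x
  choose f hf using hr
  refine ⟨f, h.mono fun z hz => ?_⟩
  have hrz : r z.1 = r z.2 := congrArg Quotient.out (Quotient.sound (s := S) hz)
  have h1 := hf z.1
  rw [hrz] at h1
  simpa [pairDiff] using (hf z.2).sub h1

theorem ScreenedSpace.completeSpace (σ : ScreeningFunction U) (s p : ℝ) [hp : Fact (1 ≤ p)]
    (hs : 0 ≤ s * p + N) : CompleteSpace (ScreenedSpace σ s p) := by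
  have hp1 : 1 ≤ ENNReal.ofReal p := ENNReal.one_le_ofReal.2 hp.out
  have hp0 : 0 < p := by linarith [hp.out]
  -- The summable rate gives a.e. convergence of the differences without passing to subsequences.
  refine EMetric.complete_of_convergent_controlled_sequences (fun n => 2⁻¹ ^ n)
    (fun n => ENNReal.pow_pos (by simp) n) fun u hu => ?_
  have hB : ∑' n : ℕ, (2⁻¹ : ℝ≥0∞) ^ n ≠ ∞ := by
    rw [ENNReal.tsum_geometric]
    simp
  have hcau : ∀ n k m : ℕ, n ≤ k → n ≤ m →
      eLpNorm (pairDiff (u k).toFun - pairDiff (u m).toFun) (ENNReal.ofReal p)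
        (screenedMeasure σ s p) < 2⁻¹ ^ n := fun n k m hk hm => by
    have := hu n k m hk hm
    rwa [edist_eq_enorm_sub, enorm_eq_eLpNorm, toFun_sub, pairDiff_sub] at this
  have hmeas := fun n => (u n).memLp_pairDiff.aestronglyMeasurable
  obtain ⟨f, hf⟩ := exists_tendsto_pairDiff (fun n => (u n).toFun)
    (Lp.ae_tendsto_of_cauchy_eLpNorm hmeas hp1 hB hcau)
  have hlim := Lp.cauchy_tendsto_of_tendsto hmeas (pairDiff f) hB hcau hf
  have hfLp : MemLp (pairDiff f) (ENNReal.ofReal p) (screenedMeasure σ s p) :=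
    Lp.memLp_of_cauchy_tendsto hp1 (fun n => (u n).memLp_pairDiff) _
      (aestronglyMeasurable_of_tendsto_ae _ hmeas hf) hlim
  have hfint := locallyIntegrable_of_memLp_pairDiff σ hp.out hs hfLp
  let F : ScreenedSpace σ s p := ⟨f, hfint, by
    rw [screenedSeminorm_eq_eLpNorm σ hp0 hfint]
    exact hfLp.2⟩
  refine ⟨F, tendsto_iff_edist_tendsto_0.2 (hlim.congr fun n => ?_)⟩
  rw [edist_eq_enorm_sub, enorm_eq_eLpNorm, toFun_sub, pairDiff_sub]
  rfl

end Completeness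

/-! ### The null space of the seminorm and the closedness of `locallyConstants`. -/

section Constants

theorem exists_ae_eq_const_of_pairDiff_eq_zero {f : U → ℝ} {A B : Set U} (hA : IsOpen A) {x : U}
    (hx : x ∈ A) (h : ∀ᵐ z ∂((lebesgueOn U).restrict A).prod ((lebesgueOn U).restrict B),
      pairDiff f z = 0) :
    ∃ c, ∀ᵐ y ∂(lebesgueOn U).restrict B, f y = c := by
  have := ae_restrict_neBot_of_isOpen hA hx
  obtain ⟨a, ha⟩ := (Measure.ae_ae_of_ae_prod h).exists
  exact ⟨f a, ha.mono fun y hy => sub_eq_zero.1 hy⟩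

/-- Overlapping neighbourhoods meet in a nonempty open set, which has positive measure, so their
constants agree. Locally null sets are null, so the local equalities glue. -/
theorem exists_isLocallyConstant_ae_eq {f : U → ℝ}
    (h : ∀ x : U, ∃ B : Set U, IsOpen B ∧ x ∈ B ∧
      ∃ c, ∀ᵐ y ∂(lebesgueOn U).restrict B, f y = c) :
    ∃ g : U → ℝ, IsLocallyConstant g ∧ f =ᵐ[lebesgueOn U] g := by
  choose B hB hxB g hg using h
  have hgB : ∀ x, ∀ y ∈ B x, g y = g x := fun x y hy => by
    have := ae_restrict_neBot_of_isOpen ((hB x).inter (hB y)) ⟨hy, hxB y⟩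
    have h1 := ae_restrict_of_ae_restrict_of_subset (Set.inter_subset_left (t := B y)) (hg x)
    have h2 := ae_restrict_of_ae_restrict_of_subset (Set.inter_subset_right (s := B x)) (hg y)
    obtain ⟨z, h3, h4⟩ := (h1.and h2).exists
    exact h4.symm.trans h3
  refine ⟨g, (IsLocallyConstant.iff_exists_open g).2 fun x => ⟨B x, hB x, hxB x, hgB x⟩, ?_⟩
  refine measure_null_of_locally_null _ fun x _ =>
    ⟨_, inter_mem_nhdsWithin _ ((hB x).mem_nhds (hxB x)), ?_⟩
  have h1 := (ae_restrict_iff' (hB x).measurableSet).1 (hg x)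
  refine measure_mono_null ?_ (ae_iff.1 h1)
  rintro y ⟨hy, hyB⟩
  exact fun hyx => hy ((hyx hyB).trans (hgB x y hyB).symm)

variable {σ : ScreeningFunction U} {s p : ℝ} [hp : Fact (1 ≤ p)]

theorem isOpen_connectedComponent_opens (x : U) : IsOpen (connectedComponent x) := by
  have : LocallyConnectedSpace U := U.isOpen.locallyConnectedSpace
  exact isOpen_connectedComponent

theorem mem_locallyConstants_iff {f : ScreenedSpace σ s p} :
    f ∈ locallyConstants σ s p ↔
      ∃ g : U → ℝ, IsLocallyConstant g ∧ f.toFun =ᵐ[lebesgueOn U] g := by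
  constructor
  · intro hf
    refine exists_isLocallyConstant_ae_eq fun x => ?_
    obtain ⟨c, hc⟩ := hf x
    exact ⟨_, isOpen_connectedComponent_opens x, mem_connectedComponent, c,
      (ae_restrict_iff' (isOpen_connectedComponent_opens x).measurableSet).2 hc⟩
  · rintro ⟨g, hg, hfg⟩ x
    refine ⟨g x, hfg.mono fun z hz hzx => ?_⟩
    rw [hz]
    exact hg.apply_eq_of_isPreconnected isPreconnected_connectedComponent hzx mem_connectedComponent

/-- One locally constant representative `g` replaces the separate constants and null sets, so that
links can be tested pointwise. -/
theorem mem_linkedConstants_iff {f : ScreenedSpace σ s p} :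
    f ∈ linkedConstants σ s p ↔
      ∃ g : U → ℝ, IsLocallyConstant g ∧ f.toFun =ᵐ[lebesgueOn U] g ∧
        ∀ x y, edist y x < σ.toFun x → g y = g x := by
  constructor
  · intro hf
    have hmem : f ∈ locallyConstants σ s p := fun x => by
      obtain ⟨c, hc⟩ := hf x x (by simpa using σ.pos x)
      exact ⟨c, hc.mono fun z hz hzx => hz (.inl hzx)⟩
    obtain ⟨g, hg, hfg⟩ := mem_locallyConstants_iff.1 hmem
    refine ⟨g, hg, hfg, fun x y hxy => ?_⟩
    obtain ⟨c, hc⟩ := hf x y hxy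
    have key : ∀ w, connectedComponent w ⊆ connectedComponent x ∪ connectedComponent y →
        g w = c := fun w hw => by
      have := ae_restrict_neBot_of_isOpen (isOpen_connectedComponent_opens w)
        mem_connectedComponent
      obtain ⟨z, ⟨h1, h2⟩, h3⟩ := (((ae_restrict_of_ae hc).and (ae_restrict_of_ae hfg)).and
        (ae_restrict_mem (isOpen_connectedComponent_opens w).measurableSet)).exists
      rw [← h1 (hw h3), h2]
      exact hg.apply_eq_of_isPreconnected isPreconnected_connectedComponent
        mem_connectedComponent h3
    rw [key x Set.subset_union_left, key y Set.subset_union_right]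
  · rintro ⟨g, hg, hfg, hσ⟩ x y hxy
    refine ⟨g x, hfg.mono fun z hz hzx => ?_⟩
    rw [hz]
    rcases hzx with hzx | hzx
    · exact hg.apply_eq_of_isPreconnected isPreconnected_connectedComponent hzx
        mem_connectedComponent
    · rw [← hσ x y hxy]
      exact hg.apply_eq_of_isPreconnected isPreconnected_connectedComponent hzx
        mem_connectedComponent

theorem norm_eq_zero_iff_pairDiff (f : ScreenedSpace σ s p) :
    ‖f‖ = 0 ↔ ∀ᵐ z ∂screenedMeasure σ s p, pairDiff f.toFun z = 0 := by
  have hp0 : 0 < p := by linarith [hp.out]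
  rw [f.norm_eq_eLpNorm, ENNReal.toReal_eq_zero_iff, or_iff_left f.memLp_pairDiff.2.ne,
    eLpNorm_eq_zero_iff f.memLp_pairDiff.1 (by simpa using hp0)]
  rfl

theorem norm_eq_zero_iff_mem_linkedConstants (hs : 0 ≤ s * p + N) (f : ScreenedSpace σ s p) :
    ‖f‖ = 0 ↔ f ∈ linkedConstants σ s p := by
  rw [norm_eq_zero_iff_pairDiff, mem_linkedConstants_iff]
  constructor
  · intro h
    have hloc : ∀ x y : U, edist y x < σ.toFun x → ∃ A B : Set U, IsOpen A ∧ IsOpen B ∧ x ∈ A ∧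
        y ∈ B ∧ ∀ᵐ z ∂((lebesgueOn U).restrict A).prod ((lebesgueOn U).restrict B),
          pairDiff f.toFun z = 0 := fun x y hxy => by
      obtain ⟨A, B, hA, hB, hxA, hyB, -, -, c, -, hle⟩ :=
        exists_prod_restrict_le_screenedMeasure σ hs hxy
      exact ⟨A, B, hA, hB, hxA, hyB,
        (Measure.absolutelyContinuous_of_le_smul hle).ae_le h⟩
    obtain ⟨g, hg, hfg⟩ := exists_isLocallyConstant_ae_eq (f := f.toFun) fun x => by
      obtain ⟨A, B, hA, hB, hxA, hxB, hz⟩ := hloc x x (by simpa using σ.pos x)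
      exact ⟨B, hB, hxB, exists_ae_eq_const_of_pairDiff_eq_zero hA hxA hz⟩
    refine ⟨g, hg, hfg, fun x y hxy => ?_⟩
    obtain ⟨A, B, hA, hB, hxA, hyB, hz⟩ := hloc x y hxy
    -- On the shrunken sets `g` is `g x`, respectively `g y`; a generic pair `(a, b)` there
    -- transfers `f b = f a` to `g`.
    have hA' := hA.inter (hg {g x})
    have hB' := hB.inter (hg {g y})
    have := ae_restrict_neBot_of_isOpen hA' (x := x) ⟨hxA, rfl⟩
    have := ae_restrict_neBot_of_isOpen hB' (x := y) ⟨hyB, rfl⟩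
    obtain ⟨a, ⟨ha1, ha2⟩, ha3⟩ := (((ae_restrict_of_ae_restrict_of_subset Set.inter_subset_left
      (Measure.ae_ae_of_ae_prod hz)).and (ae_restrict_of_ae hfg)).and
      (ae_restrict_mem hA'.measurableSet)).exists
    obtain ⟨b, ⟨hb1, hb2⟩, hb3⟩ := (((ae_restrict_of_ae_restrict_of_subset Set.inter_subset_left
      ha1).and (ae_restrict_of_ae hfg)).and (ae_restrict_mem hB'.measurableSet)).exists
    have h1 : g a = g x := ha3.2
    have h2 : g b = g y := hb3.2
    rw [← h1, ← h2, ← ha2, ← hb2]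
    exact sub_eq_zero.1 hb1
  · rintro ⟨g, -, hfg, hσ⟩
    rw [ae_screenedMeasure_iff σ s p hs]
    filter_upwards [Measure.quasiMeasurePreserving_fst.ae hfg,
      Measure.quasiMeasurePreserving_snd.ae hfg] with z h1 h2 hz
    rw [pairDiff, h1, h2, hσ z.1 z.2 hz, sub_self]

theorem isClosed_locallyConstants (hs : 0 ≤ s * p + N) :
    IsClosed (locallyConstants σ s p : Set (ScreenedSpace σ s p)) := by
  have hp0 : 0 < p := by linarith [hp.out]
  refine isClosed_of_closure_subset fun f hf => ?_
  refine mem_locallyConstants_iff.2 (exists_isLocallyConstant_ae_eq fun x => ?_)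
  obtain ⟨A, B, hA, hB, hxA, hxB, -, -, c, hc, hle⟩ :=
    exists_prod_restrict_le_screenedMeasure σ hs (x := x) (y := x) (by simpa using σ.pos x)
  -- Every member of `locallyConstants` is a.e. constant on `D`, so subtracting it does not affect
  -- `pairDiff f` on `D × D`. Hence that norm is at most `M * edist f k` for every such `k`, and
  -- vanishes on the closure.
  set D := A ∩ B ∩ connectedComponent x
  have hD : IsOpen D := (hA.inter hB).inter (isOpen_connectedComponent_opens x)
  have hxD : x ∈ D := ⟨⟨hxA, hxB⟩, mem_connectedComponent⟩
  set lam := ((lebesgueOn U).restrict D).prod ((lebesgueOn U).restrict D)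
  have hlam : lam ≤ c • screenedMeasure σ s p := by
    refine le_trans ?_ hle
    simp only [lam, Measure.prod_restrict]
    exact Measure.restrict_mono (Set.prod_mono (fun z hz => hz.1.1) fun z hz => hz.1.2) le_rfl
  have hzero : eLpNorm (pairDiff f.toFun) (ENNReal.ofReal p) lam = 0 := by
    set M := c ^ (1 / ENNReal.ofReal p).toReal
    have hM : M ≠ ∞ := ENNReal.rpow_ne_top_of_nonneg ENNReal.toReal_nonneg hc
    have hbound : ∀ k ∈ locallyConstants σ s p,
        eLpNorm (pairDiff f.toFun) (ENNReal.ofReal p) lam ≤ M * edist f k := fun k hk => by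
      obtain ⟨a, ha⟩ := hk x
      have hkD : ∀ᵐ y ∂(lebesgueOn U).restrict D, k.toFun y = a :=
        (ae_restrict_iff' hD.measurableSet).2 (ha.mono fun y hy hyD => hy hyD.2)
      have heq : pairDiff f.toFun =ᵐ[lam] pairDiff (f - k).toFun := by
        filter_upwards [Measure.quasiMeasurePreserving_fst.ae hkD,
          Measure.quasiMeasurePreserving_snd.ae hkD] with z h1 h2
        rw [ScreenedSpace.toFun_sub, pairDiff_sub, Pi.sub_apply, pairDiff, pairDiff, h1, h2]
        ring
      rw [eLpNorm_congr_ae heq, edist_eq_enorm_sub, ScreenedSpace.enorm_eq_eLpNorm]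
      exact eLpNorm_le_of_measure_le_smul hlam
    obtain ⟨k, hk, hkf⟩ := mem_closure_iff_seq_limit.1 hf
    have hlim : Filter.Tendsto (fun n => M * edist f (k n)) Filter.atTop (𝓝 0) := by
      have h := ENNReal.Tendsto.const_mul (a := M)
        (tendsto_const_nhds.edist hkf : Filter.Tendsto (fun n => edist f (k n)) _ _) (.inr hM)
      rwa [edist_self, mul_zero] at h
    exact le_antisymm (ge_of_tendsto' hlim fun n => hbound _ (hk n)) zero_le
  rw [eLpNorm_eq_zero_iff (f.memLp_pairDiff.of_measure_le_smul hc hlam).1 (by simpa using hp0)]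
    at hzero
  exact ⟨D, hD, hxD, exists_ae_eq_const_of_pairDiff_eq_zero hD hxD hzero⟩

end Constants

/-! ### Quotient norms and closed subspaces. -/

section Quotients

/-- Representatives differ by null vectors, so all have the same norm and the infimum is trivial. -/
theorem norm_mk_eq_norm_of_forall_norm_eq_zero {E : Type*} [SeminormedAddCommGroup E]
    [NormedSpace ℝ E] {S : Submodule ℝ E} (hS : ∀ k ∈ S, ‖k‖ = 0) (f : E) :
    ‖(Submodule.Quotient.mk f : E ⧸ S)‖ = ‖f‖ := by
  refine le_antisymm (Submodule.Quotient.norm_mk_le (S := S) f) ?_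
  refine QuotientAddGroup.le_norm_iff.2 fun m hm => ?_
  have hk : ‖f - m‖ = 0 := hS _ ((Submodule.Quotient.eq S).1 hm.symm)
  have := norm_le_norm_add_norm_sub' f m
  rwa [hk, add_zero] at this

theorem norm_mk_eq_iInf {E : Type*} [SeminormedAddCommGroup E] [NormedSpace ℝ E]
    (S : Submodule ℝ E) (f : E) :
    ‖(Submodule.Quotient.mk f : E ⧸ S)‖ = ⨅ k : S, ‖f - k‖ := by
  have h := QuotientAddGroup.norm_mk (S := S.toAddSubgroup) f
  rw [Metric.infDist_eq_iInf] at h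
  simp only [dist_eq_norm] at h
  exact h

theorem isBanachSpace_quotient {E : Type*} [SeminormedAddCommGroup E] [NormedSpace ℝ E]
    [CompleteSpace E] {S : Submodule ℝ E} (hS : IsClosed (S : Set E)) :
    IsBanachSpace (E ⧸ S) := by
  refine ⟨fun x hx => ?_, inferInstance⟩
  obtain ⟨f, rfl⟩ := Submodule.Quotient.mk_surjective S x
  refine (Submodule.Quotient.mk_eq_zero S).2 ?_
  have h := (QuotientAddGroup.norm_mk_eq_zero_iff_mem_closure (S := S.toAddSubgroup)).1 hx
  exact hS.closure_subset h

variable {σ : ScreeningFunction U} {s p : ℝ} [hp : Fact (1 ≤ p)]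

theorem isClosed_linkedConstants (hs : 0 ≤ s * p + N) :
    IsClosed (linkedConstants σ s p : Set (ScreenedSpace σ s p)) := by
  have : (linkedConstants σ s p : Set (ScreenedSpace σ s p)) = {f | ‖f‖ = 0} := by
    ext f
    exact (norm_eq_zero_iff_mem_linkedConstants hs f).symm
  rw [this]
  exact isClosed_eq continuous_norm continuous_const

theorem linkedConstants_eq_locallyConstants
    (h : ∀ x y : U, edist y x < σ.toFun x → y ∈ connectedComponent x) :
    linkedConstants σ s p = locallyConstants σ s p := by
  ext f
  rw [mem_linkedConstants_iff, mem_locallyConstants_iff]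
  constructor
  · rintro ⟨g, hg, hfg, -⟩
    exact ⟨g, hg, hfg⟩
  · rintro ⟨g, hg, hfg⟩
    exact ⟨g, hg, hfg, fun x y hxy => hg.apply_eq_of_isPreconnected
      isPreconnected_connectedComponent (h x y hxy) mem_connectedComponent⟩

end Quotients

end

theorem theorem3p6 {N : ℕ} (U : Opens (EuclideanSpace ℝ (Fin N))) (σ : ScreeningFunction U)
    (s p : ℝ) [Fact (1 ≤ p)] (hs0 : 0 < s) (hs1 : s < 1) :
    -- modulo the functions constant in each component, equal on linked components:
    -- the norm is the screened seminorm
    ((∀ f : ScreenedSpace σ s p,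
        ‖(Submodule.Quotient.mk f : ScreenedSpace σ s p ⧸ linkedConstants σ s p)‖
          = (screenedSeminorm σ s p f.toFun).toReal) ∧
      IsBanachSpace (ScreenedSpace σ s p ⧸ linkedConstants σ s p) ∧
      (1 < p → IsReflexiveSpace (ScreenedSpace σ s p ⧸ linkedConstants σ s p))) ∧
    -- modulo all functions constant in each component, with the quotient norm
    ((∀ f : ScreenedSpace σ s p,
        ‖(Submodule.Quotient.mk f : ScreenedSpace σ s p ⧸ locallyConstants σ s p)‖
          = ⨅ k : locallyConstants σ s p,
              (screenedSeminorm σ s p (f.toFun - k.1.toFun)).toReal) ∧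
      IsBanachSpace (ScreenedSpace σ s p ⧸ locallyConstants σ s p) ∧
      (1 < p → IsReflexiveSpace (ScreenedSpace σ s p ⧸ locallyConstants σ s p))) ∧
    -- if no two distinct components are linked, the quotients and their norms coincide
    ((∀ x y : U, edist y x < σ.toFun x → y ∈ connectedComponent x) →
      linkedConstants σ s p = locallyConstants σ s p ∧
      ∀ f : ScreenedSpace σ s p,
        ‖(Submodule.Quotient.mk f : ScreenedSpace σ s p ⧸ locallyConstants σ s p)‖
          = (screenedSeminorm σ s p f.toFun).toReal) := by
  have hp : 1 ≤ p := Fact.out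
  have hs : 0 ≤ s * p + N := by positivity
  have := ScreenedSpace.completeSpace σ s p hs
  have hnorm (f : ScreenedSpace σ s p) :
      ‖(Submodule.Quotient.mk f : ScreenedSpace σ s p ⧸ linkedConstants σ s p)‖
        = (screenedSeminorm σ s p f.toFun).toReal :=
    norm_mk_eq_norm_of_forall_norm_eq_zero
      (fun k hk => (norm_eq_zero_iff_mem_linkedConstants hs k).2 hk) f
  -- Uniform convexity and completeness pass to the quotient by any subspace, so both reflexivity
  -- claims are one.
  have hrefl (S : Submodule ℝ (ScreenedSpace σ s p)) (hp1 : 1 < p) :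
      IsReflexiveSpace (ScreenedSpace σ s p ⧸ S) :=
    ((ScreenedSpace.isPowerUniformlyConvex hp1).quotient (by linarith) S).isReflexiveSpace
      (by linarith)
  refine ⟨⟨hnorm, isBanachSpace_quotient (isClosed_linkedConstants hs), hrefl _⟩,
    ⟨fun f => norm_mk_eq_iInf _ f, isBanachSpace_quotient (isClosed_locallyConstants hs),
      hrefl _⟩, fun h => ?_⟩
  have heq := linkedConstants_eq_locallyConstants (σ := σ) (s := s) (p := p) h
  exact ⟨heq, heq ▸ hnorm⟩
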